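/- Let $d\ge 1$ and $p\ge 0$ be integers. There is a constant $C>0$, depending only on $d$ and $p$, such that the following holds. Let $T\subset\mathbb{R}^d$ be a convex set with non-empty interior (for example, a bounded convex domain with piecewise smooth boundary; no regularity of $\partial T$ is required), let $r$ be the radius of the largest ball inscribed in $T$ (assumed to exist, which is automatic when $T$ is bounded), and let $v$ be a real polynomial in $d$ variables of total degree at most $p$. Then $$\|\nabla v\|_{L^2(T)}\le \frac{C}{r}\,\|v\|_{L^2(T)}\qquad\text{and}\qquad \|v\|_{L^2(\partial T)}\le \frac{C}{r^{1/2}}\,\|v\|_{L^2(T)}.$$ Here $L^2(T)$ is taken with respect to Lebesgue measure, and $L^2(\partial T)$ with respect to the surface measure, i.e. the $(d-1)$-dimensional Hausdorff measure on the topological boundary $\partial T$; norms may take the value $+\infty$ when $T$ is unbounded. -/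

import Mathlib

open MeasureTheory

noncomputable section

/-- The function on Euclidean space `ℝ^d` given by a real polynomial in `d` variables. -/
def polyFun {d : ℕ} (v : MvPolynomial (Fin d) ℝ) (x : EuclideanSpace ℝ (Fin d)) : ℝ :=
  MvPolynomial.eval (fun i => x i) v

/-- `r` is the radius of the largest ball inscribed in `T`. Open balls are used, so that an open
convex set and its closure have the same inscribed radii. -/
def IsInradius {d : ℕ} (T : Set (EuclideanSpace ℝ (Fin d))) (r : ℝ) : Prop :=
  IsGreatest {ρ : ℝ | ∃ c, Metric.ball c ρ ⊆ T} r

/-- The surface measure of the boundary of `T`: the `(d-1)`-dimensional Hausdorff measure in its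
Euclidean normalization, restricted to the topological boundary of `T`. -/
def boundaryMeasure {d : ℕ} (T : Set (EuclideanSpace ℝ (Fin d))) :
    Measure (EuclideanSpace ℝ (Fin d)) :=
  (Measure.euclideanHausdorffMeasure (d - 1)).restrict (frontier T)

end

open Filter Topology
open scoped ENNReal

/-! On a line, `v` is a univariate polynomial of degree at most `p`, so its value and derivative at
a point are combinations of its values at `p + 1` nodes on the line, with coefficients depending
only on `p`. This replaces awkward points by points of `T`, without any regularity of `T`. Gradient:
a derivative at `x` is a combination of values at shifts of `x` by less than a multiple of `r`. The
shifted points may leave `T`, so each value is extrapolated from nodes towards the center `c` of the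
inscribed ball, where convexity leaves room for the shift. The resulting maps send `T` into `T` and
are homotheties of ratio at least `1/2`, which gives the L² bound. Boundary: `v x` is extrapolated
from nodes on the segment towards `c`, rescaled by `u`, and the result is averaged over `u ∈ (0,
1)`. The shrunken copies of the boundary are separated in proportion to `r`
(`dist_mul_le_dist_of_mem_frontier`), so Eilenberg's inequality bounds the averaged surface measure
by volume divided by `r` (`exists_map_homothety_le`); the square root comes from the L² norm. -/

/-! ### Polynomials sampled along lines -/

theorem exists_polynomial_eval_eq_polyFun_line {d p : ℕ} {v : MvPolynomial (Fin d) ℝ}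
    (hv : v.totalDegree ≤ p) (x h : EuclideanSpace ℝ (Fin d)) :
    ∃ q : Polynomial ℝ, q.natDegree ≤ p ∧ ∀ s : ℝ, q.eval s = polyFun v (x + s • h) := by
  refine ⟨MvPolynomial.aeval (fun i => Polynomial.C (x i) + Polynomial.X * Polynomial.C (h i)) v,
    ?_, fun s => ?_⟩
  · have := MvPolynomial.aeval_natDegree_le v hv
      (fun i => Polynomial.C (x i) + Polynomial.X * Polynomial.C (h i)) (n := 1) (fun i => by
        compute_degree)
    simpa using this
  · rw [polyFun, ← Polynomial.coe_evalRingHom, MvPolynomial.map_aeval, MvPolynomial.eval]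
    congr 2
    · ext; simp
    · ext i
      simp only [map_add, map_mul, Polynomial.coe_evalRingHom,
        Polynomial.eval_C, Polynomial.eval_X, PiLp.add_apply, PiLp.smul_apply, smul_eq_mul]

/-- Lagrange interpolation: the weights are the values of `L` on the basis polynomials. -/
theorem exists_linear_functional_eq_sum_eval {p : ℕ} {τ : Fin (p + 1) → ℝ}
    (hτ : Function.Injective τ) (L : Polynomial ℝ →ₗ[ℝ] ℝ) :
    ∃ c : Fin (p + 1) → ℝ, ∀ q : Polynomial ℝ, q.natDegree ≤ p →
      L q = ∑ i, c i * q.eval (τ i) := by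
  refine ⟨fun i => L (Lagrange.basis Finset.univ τ i), fun q hq => ?_⟩
  have hdeg : q.degree < (Finset.univ : Finset (Fin (p + 1))).card := by
    rw [Finset.card_univ, Fintype.card_fin]
    exact lt_of_le_of_lt (Polynomial.degree_le_of_natDegree_le hq) (by exact_mod_cast p.lt_succ_self)
  conv_lhs => rw [Lagrange.eq_interpolate hτ.injOn hdeg, Lagrange.interpolate_apply]
  rw [map_sum]
  refine Finset.sum_congr rfl fun i _ => ?_
  rw [← Polynomial.smul_eq_C_mul, map_smul, smul_eq_mul, mul_comm]

theorem continuous_polyFun {d : ℕ} (v : MvPolynomial (Fin d) ℝ) : Continuous (polyFun v) := by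
  unfold polyFun
  exact (MvPolynomial.continuous_eval v).comp (by fun_prop)

theorem differentiable_polyFun {d : ℕ} (v : MvPolynomial (Fin d) ℝ) :
    Differentiable ℝ (polyFun v) := by
  unfold polyFun
  induction v using MvPolynomial.induction_on with
  | C a => simp
  | add f g hf hg => simp only [map_add]; exact hf.add hg
  | mul_X f i hf =>
    simp only [map_mul, MvPolynomial.eval_X]
    exact hf.mul (by fun_prop)

theorem exists_extrapolation {d p : ℕ} {τ : Fin (p + 1) → ℝ} (hτ : Function.Injective τ) :
    ∃ c : Fin (p + 1) → ℝ, ∀ v : MvPolynomial (Fin d) ℝ, v.totalDegree ≤ p →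
      ∀ x h : EuclideanSpace ℝ (Fin d), polyFun v x = ∑ i, c i * polyFun v (x + τ i • h) := by
  obtain ⟨c, hc⟩ := exists_linear_functional_eq_sum_eval hτ (Polynomial.leval 0)
  refine ⟨c, fun v hv x h => ?_⟩
  obtain ⟨q, hq, hqe⟩ := exists_polynomial_eval_eq_polyFun_line hv x h
  have := hc q hq
  simpa [hqe] using this

theorem exists_numerical_derivative {d p : ℕ} {τ : Fin (p + 1) → ℝ} (hτ : Function.Injective τ) :
    ∃ c : Fin (p + 1) → ℝ, ∀ v : MvPolynomial (Fin d) ℝ, v.totalDegree ≤ p →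
      ∀ x h : EuclideanSpace ℝ (Fin d),
        fderiv ℝ (polyFun v) x h = ∑ i, c i * polyFun v (x + τ i • h) := by
  obtain ⟨c, hc⟩ := exists_linear_functional_eq_sum_eval hτ
    (Polynomial.leval 0 ∘ₗ Polynomial.derivative)
  refine ⟨c, fun v hv x h => ?_⟩
  obtain ⟨q, hq, hqe⟩ := exists_polynomial_eval_eq_polyFun_line hv x h
  have h1 := hc q hq
  simp only [hqe] at h1
  rw [← h1]
  have h2 : HasDerivAt (fun s => q.eval s) (q.derivative.eval 0) 0 := q.hasDerivAt 0
  have h3 : HasDerivAt (fun s : ℝ => polyFun v (x + s • h)) (fderiv ℝ (polyFun v) x h) 0 := by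
    have h4 : HasDerivAt (fun s : ℝ => x + s • h) h 0 := by
      simpa using ((hasDerivAt_id (0 : ℝ)).smul_const h).const_add x
    have h5 : HasFDerivAt (polyFun v) (fderiv ℝ (polyFun v) x) (x + (0 : ℝ) • h) := by
      simpa using (differentiable_polyFun v x).hasFDerivAt
    exact h5.comp_hasDerivAt (0 : ℝ) h4
  have h5 : (fun s => q.eval s) = fun s : ℝ => polyFun v (x + s • h) := funext hqe
  rw [h5] at h2
  simpa using h3.unique h2

/-- The equispaced nodes `(i + 1) / (2 (p + 1))` in `(0, 1/2]`. -/
noncomputable def node (p : ℕ) (i : Fin (p + 1)) : ℝ := (i + 1) / (2 * (p + 1))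

theorem node_injective (p : ℕ) : Function.Injective (node p) := by
  intro i j h
  unfold node at h
  field_simp at h
  exact Fin.ext (by exact_mod_cast add_right_cancel h)

theorem le_node (p : ℕ) (i : Fin (p + 1)) : 1 / (2 * (p + 1) : ℝ) ≤ node p i := by
  unfold node
  gcongr
  simp

theorem node_pos (p : ℕ) (i : Fin (p + 1)) : 0 < node p i :=
  lt_of_lt_of_le (by positivity) (le_node p i)

theorem node_le_half (p : ℕ) (i : Fin (p + 1)) : node p i ≤ 1 / 2 := by
  unfold node
  rw [div_le_div_iff₀ (by positivity) (by norm_num)]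
  have : (i : ℝ) + 1 ≤ p + 1 := by exact_mod_cast i.2
  linarith

/-! ### L² estimates and the gradient bound -/

theorem eLpNorm_comp_le_of_map_le {α β : Type*} [MeasurableSpace α] [MeasurableSpace β]
    {μ : Measure α} {ν : Measure β} {φ : α → β} (hφ : Measurable φ) {K : ℝ}
    (h : Measure.map φ μ ≤ ENNReal.ofReal K • ν) {f : β → ℝ} (hf : StronglyMeasurable f) :
    eLpNorm (f ∘ φ) 2 μ ≤ ENNReal.ofReal √K * eLpNorm f 2 ν := by
  rw [← eLpNorm_map_measure hf.aestronglyMeasurable hφ.aemeasurable]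
  refine (eLpNorm_mono_measure f h).trans ?_
  rw [eLpNorm_smul_measure_of_ne_top (by norm_num), smul_eq_mul]
  gcongr
  rcases le_total K 0 with hK | hK
  · simp [ENNReal.ofReal_of_nonpos hK]
  · rw [ENNReal.ofReal_rpow_of_nonneg hK (by positivity), Real.sqrt_eq_rpow]
    simp

theorem eLpNorm_sum_mul_le {ι α : Type*} [Fintype ι] [MeasurableSpace α] {μ : Measure α}
    (c : ι → ℝ) (g : ι → α → ℝ) (hg : ∀ i, AEStronglyMeasurable (g i) μ) {K : ℝ} (hK : 0 ≤ K)
    {M : ENNReal} (h : ∀ i, eLpNorm (g i) 2 μ ≤ ENNReal.ofReal K * M) :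
    eLpNorm (fun x => ∑ i, c i * g i x) 2 μ ≤ ENNReal.ofReal ((∑ i, |c i|) * K) * M := by
  have h1 : (fun x => ∑ i, c i * g i x) = ∑ i, c i • g i := by
    ext x; simp
  rw [h1]
  refine (eLpNorm_sum_le (fun i _ => (hg i).const_smul (c i)) (by norm_num)).trans ?_
  have h2 : ∀ i, eLpNorm (c i • g i) 2 μ ≤ ENNReal.ofReal (|c i| * K) * M := fun i => by
    rw [eLpNorm_const_smul, ENNReal.ofReal_mul (abs_nonneg _), mul_assoc, ← Real.norm_eq_abs,
      ofReal_norm]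
    gcongr
    exact h i
  refine (Finset.sum_le_sum fun i _ => h2 i).trans ?_
  rw [← Finset.sum_mul, Finset.sum_mul Finset.univ _ K, ENNReal.ofReal_sum_of_nonneg]
  intros; positivity

theorem map_volume_restrict_homothety_le {d : ℕ} {T : Set (EuclideanSpace ℝ (Fin d))}
    {s : ℝ} (hs : 1 / 2 ≤ s) (b : EuclideanSpace ℝ (Fin d))
    (hmaps : ∀ x ∈ T, s • x + b ∈ T) :
    Measure.map (fun x => s • x + b) (volume.restrict T)
      ≤ ENNReal.ofReal (2 ^ d) • volume.restrict T := by
  have hs0 : s ≠ 0 := by linarith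
  refine Measure.le_iff.2 fun B hB => ?_
  have hm : Measurable fun x : EuclideanSpace ℝ (Fin d) => s • x + b := by fun_prop
  rw [Measure.map_apply hm hB, Measure.restrict_apply (hm hB), Measure.smul_apply,
    Measure.restrict_apply hB, smul_eq_mul]
  calc volume ((fun x => s • x + b) ⁻¹' B ∩ T)
      ≤ volume ((s • ·) ⁻¹' ((· + b) ⁻¹' (B ∩ T))) :=
        measure_mono fun x hx => ⟨hx.1, hmaps x hx.2⟩
    _ = ENNReal.ofReal (abs (s ^ d)⁻¹) * volume (B ∩ T) := by
        rw [Measure.addHaar_preimage_smul _ hs0, measure_preimage_add_right]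
        simp
    _ ≤ _ := by
        gcongr
        rw [← inv_pow, abs_pow]
        gcongr
        rw [abs_of_pos (by positivity)]
        exact inv_le_of_inv_le₀ (by norm_num) (by linarith)

theorem eLpNorm_gradient_le_sum {d : ℕ} {v : MvPolynomial (Fin d) ℝ}
    {μ : Measure (EuclideanSpace ℝ (Fin d))} {M : ENNReal}
    (hm : ∀ e, AEStronglyMeasurable (fun x => fderiv ℝ (polyFun v) x e) μ)
    (h : ∀ e : EuclideanSpace ℝ (Fin d), ‖e‖ = 1 →
      eLpNorm (fun x => fderiv ℝ (polyFun v) x e) 2 μ ≤ M) :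
    eLpNorm (gradient (polyFun v)) 2 μ ≤ d * M := by
  set e : Fin d → EuclideanSpace ℝ (Fin d) := fun i => EuclideanSpace.single i 1 with he
  have h1 : ∀ x, ‖gradient (polyFun v) x‖ ≤ ∑ i, ‖fderiv ℝ (polyFun v) x (e i)‖ := fun x => by
    have h2 : gradient (polyFun v) x = ∑ i, (fderiv ℝ (polyFun v) x (e i)) • e i := by
      conv_lhs => rw [← (EuclideanSpace.basisFun (Fin d) ℝ).sum_repr' (gradient (polyFun v) x)]
      refine Finset.sum_congr rfl fun i _ => ?_
      rw [EuclideanSpace.basisFun_apply, real_inner_comm, gradient, InnerProductSpace.toDual_symm_apply]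
    rw [h2]
    refine (norm_sum_le _ _).trans (Finset.sum_le_sum fun i _ => ?_)
    simp [he, norm_smul]
  calc eLpNorm (gradient (polyFun v)) 2 μ
      ≤ eLpNorm (∑ i, fun x => ‖fderiv ℝ (polyFun v) x (e i)‖) 2 μ := by
        refine eLpNorm_mono_real fun x => ?_
        simpa using h1 x
    _ ≤ ∑ i, eLpNorm (fun x => ‖fderiv ℝ (polyFun v) x (e i)‖) 2 μ :=
        eLpNorm_sum_le (fun i _ => (hm (e i)).norm) (by norm_num)
    _ ≤ ∑ i : Fin d, M := by
        refine Finset.sum_le_sum fun i _ => ?_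
        rw [eLpNorm_norm]
        exact h _ (by simp [he])
    _ = d * M := by simp

theorem exists_eLpNorm_gradient_le (d p : ℕ) :
    ∃ C : ℝ, 0 ≤ C ∧ ∀ (T : Set (EuclideanSpace ℝ (Fin d))) (r : ℝ)
      (c : EuclideanSpace ℝ (Fin d)), Convex ℝ T → 0 < r → Metric.ball c r ⊆ T →
        ∀ v : MvPolynomial (Fin d) ℝ, v.totalDegree ≤ p →
          eLpNorm (gradient (polyFun v)) 2 (volume.restrict T)
              ≤ ENNReal.ofReal (C / r) * eLpNorm (polyFun v) 2 (volume.restrict T) := by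
  obtain ⟨a, ha⟩ := exists_extrapolation (d := d) (node_injective p)
  obtain ⟨a', ha'⟩ := exists_numerical_derivative (d := d) (node_injective p)
  -- `δ` is the smallest node, so a shift of length `node p j * (r * δ)` is shorter than `node p i *
  -- r` for all `i`, `j`.
  set δ : ℝ := 1 / (2 * (p + 1)) with hδ
  have hδ0 : 0 < δ := by positivity
  refine ⟨d * ((∑ j, |a' j|) * ((∑ i, |a i|) * √(2 ^ d)) / δ), by positivity, ?_⟩
  intro T r c hT hr hc v hv
  set M := eLpNorm (polyFun v) 2 (volume.restrict T)
  have key : ∀ (e : EuclideanSpace ℝ (Fin d)), ‖e‖ = 1 → ∀ j i,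
      eLpNorm (fun x => polyFun v (x + node p j • (r * δ) • e +
        node p i • (c - x))) 2 (volume.restrict T) ≤ ENNReal.ofReal √(2 ^ d) * M := by
    intro e he j i
    have hi := le_node p i
    have hi2 := node_le_half p i
    have hj := node_le_half p j
    have hj0 := node_pos p j
    have hi0 := node_pos p i
    have hmaps : ∀ x ∈ T, (1 - node p i) • x +
        (node p i • c + node p j • (r * δ) • e) ∈ T := by
      intro x hx
      -- The shift is absorbed into the center: the image of `x` is a convex combination of `x` and
      -- this point of the inscribed ball.
      have h1 : c + ((node p i)⁻¹ * node p j * (r * δ)) • e ∈ T := by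
        apply hc
        rw [Metric.mem_ball, dist_eq_norm, add_sub_cancel_left, norm_smul, he, mul_one,
          Real.norm_of_nonneg (by positivity)]
        rw [mul_assoc, inv_mul_lt_iff₀ hi0]
        nlinarith [mul_pos hr hδ0, mul_le_mul_of_nonneg_left hi hr.le]
      have h2 := hT hx h1 (by linarith : 0 ≤ 1 - node p i) hi0.le (by ring)
      convert h2 using 2
      rw [smul_add, smul_smul, smul_smul]
      congr 2
      field_simp
    have h3 := map_volume_restrict_homothety_le (by linarith) _ hmaps
    have h4 := eLpNorm_comp_le_of_map_le (by fun_prop) h3 (continuous_polyFun v).stronglyMeasurable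
    convert h4 using 2
    ext x
    simp only [Function.comp]
    congr 1
    module
  have cont : ∀ e : EuclideanSpace ℝ (Fin d), Continuous fun x => fderiv ℝ (polyFun v) x e := by
    intro e
    have : (fun x => fderiv ℝ (polyFun v) x e)
        = fun x => ∑ i, a' i * polyFun v (x + node p i • e) := by
      ext x; exact ha' v hv x e
    rw [this]
    have := continuous_polyFun v
    fun_prop
  have hv0 := continuous_polyFun v
  have hdir : ∀ e : EuclideanSpace ℝ (Fin d), ‖e‖ = 1 →
      eLpNorm (fun x => fderiv ℝ (polyFun v) x e) 2 (volume.restrict T) ≤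
        ENNReal.ofReal ((∑ j, |a' j|) * ((∑ i, |a i|) * √(2 ^ d)) / δ / r) * M := by
    intro e he
    -- Numerical differentiation with step `r * δ`, then extrapolation of each sample along `c - x`.
    have h1 : ∀ x, fderiv ℝ (polyFun v) x e = ∑ j, ((r * δ)⁻¹ * a' j) *
        ∑ i, a i * polyFun v (x + node p j • (r * δ) • e + node p i • (c - x)) := by
      intro x
      simp_rw [← ha v hv, mul_assoc, ← Finset.mul_sum]
      rw [← ha' v hv, map_smul, smul_eq_mul, inv_mul_cancel_left₀ (by positivity)]
    rw [funext h1]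
    refine (eLpNorm_sum_mul_le (K := (∑ i, |a i|) * √(2 ^ d)) (M := M) _ _ (fun j => ?_)
      (by positivity) fun j => ?_).trans_eq ?_
    · exact Continuous.aestronglyMeasurable (by fun_prop)
    · exact eLpNorm_sum_mul_le _ _ (fun i => Continuous.aestronglyMeasurable (by fun_prop))
        (by positivity) (key e he j)
    · congr 2
      simp_rw [abs_mul, ← Finset.mul_sum]
      rw [abs_of_pos (by positivity)]
      field_simp
  refine (eLpNorm_gradient_le_sum (fun e => (cont e).aestronglyMeasurable) hdir).trans_eq ?_
  rw [← mul_assoc, ← ENNReal.ofReal_natCast, ← ENNReal.ofReal_mul (by positivity)]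
  congr 2
  ring

/-! ### Eilenberg's inequality -/

theorem exists_cover_tsum_le_hausdorffMeasure_add {X : Type*} [EMetricSpace X] [MeasurableSpace X]
    [BorelSpace X] {d : ℝ} {s : Set X} (hs : μH[d] s ≠ ∞) {r ε : ℝ≥0∞} (hr : 0 < r) (hε : ε ≠ 0) :
    ∃ t : ℕ → Set X, s ⊆ ⋃ n, t n ∧ (∀ n, Metric.ediam (t n) ≤ r) ∧
      ∑' n, ⨆ _ : (t n).Nonempty, Metric.ediam (t n) ^ d ≤ μH[d] s + ε := by
  have h1 : (⨅ (t : ℕ → Set X) (_ : s ⊆ ⋃ n, t n) (_ : ∀ n, Metric.ediam (t n) ≤ r),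
      ∑' n, ⨆ _ : (t n).Nonempty, Metric.ediam (t n) ^ d) < μH[d] s + ε := by
    refine lt_of_le_of_lt ?_ (ENNReal.lt_add_right hs hε)
    rw [Measure.hausdorffMeasure_apply]
    exact le_iSup₂_of_le r hr le_rfl
  simp only [iInf_lt_iff] at h1
  obtain ⟨t, ht, htr, hlt⟩ := h1
  exact ⟨t, ht, htr, hlt.le⟩

/-- Eilenberg's inequality for a family of sets whose parameter is a Lipschitz function of the
point. -/
theorem lintegral_hausdorffMeasure_le {X : Type*} [EMetricSpace X] [MeasurableSpace X]
    [BorelSpace X] {m : ℝ} (hm : 0 ≤ m) {L : ℝ≥0∞} (hL0 : L ≠ 0) (hL : L ≠ ∞) (A : ℝ → Set X)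
    (hA : ∀ u u' y y', y ∈ A u → y' ∈ A u' → edist u u' ≤ L * edist y y') {S : Set X}
    (hS : ∀ u, A u ⊆ S) :
    ∫⁻ u, μH[m] (A u) ≤ L * μH[m + 1] S := by
  by_cases hfin : μH[m + 1] S = ∞
  · simp [hfin, hL0]
  set ε : ℕ → ℝ≥0∞ := fun n => ((n : ℝ≥0∞) + 1)⁻¹ with hε
  have hε0 : ∀ n, ε n ≠ 0 := fun n => by simp [hε]
  have hεt : Tendsto ε atTop (𝓝 0) := by
    have := (tendsto_add_atTop_iff_nat 1).2 ENNReal.tendsto_inv_nat_nhds_zero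
    simpa [hε] using this
  choose t htS htr hsum using fun n => exists_cover_tsum_le_hausdorffMeasure_add hfin
    (pos_iff_ne_zero.2 (hε0 n)) (hε0 n)
  -- The parameters whose slice meets `t n i`: by `hA` their diameter is at most `L` times that of
  -- `t n i`. The closure makes the set measurable and keeps the diameter.
  set I : ℕ → ℕ → Set ℝ := fun n i => closure {u | (t n i ∩ A u).Nonempty} with hI
  have hImeas : ∀ n i, MeasurableSet (I n i) := fun n i => isClosed_closure.measurableSet
  have hIvol : ∀ n i, volume (I n i) ≤ L * Metric.ediam (t n i) := fun n i => by
    refine (Real.volume_le_diam _).trans ?_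
    rw [hI, Metric.ediam_closure]
    refine Metric.ediam_le ?_
    rintro u ⟨y, hy, hyA⟩ u' ⟨y', hy', hyA'⟩
    exact (hA u u' y y' hyA hyA').trans (by gcongr; exact Metric.edist_le_ediam_of_mem hy hy')
  set g : ℕ → ℝ → ℝ≥0∞ := fun n u =>
    ∑' i, (I n i).indicator (fun _ => Metric.ediam (t n i) ^ m) u with hg
  have hgm : ∀ n, Measurable (g n) := fun n =>
    Measurable.tsum fun i => measurable_const.indicator (hImeas n i)
  -- The sets `t n i` with `u ∈ I n i` cover `A u` with mesh tending to zero; Fatou's lemma then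
  -- integrates this bound.
  have hpt : ∀ u, μH[m] (A u) ≤ liminf (fun n => g n u) atTop := fun u => by
    refine (Measure.hausdorffMeasure_le_liminf_tsum (ι := fun n => {i // u ∈ I n i}) m (A u) ε hεt
      (fun n i => t n i) (Eventually.of_forall fun n i => htr n i)
      (Eventually.of_forall fun n y hy => ?_)).trans_eq ?_
    · obtain ⟨i, hi⟩ := Set.mem_iUnion.1 (htS n (hS u hy))
      exact Set.mem_iUnion.2 ⟨⟨i, subset_closure ⟨y, hi, hy⟩⟩, hi⟩
    · congr 1
      ext n
      rw [hg]
      exact (tsum_subtype {i | u ∈ I n i} fun i => Metric.ediam (t n i) ^ m)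
  have hint : ∀ n, ∫⁻ u, g n u ≤ L * (μH[m + 1] S + ε n) := fun n => by
    rw [hg]
    simp only
    rw [lintegral_tsum fun i => (measurable_const.indicator (hImeas n i)).aemeasurable]
    calc ∑' i, ∫⁻ u, (I n i).indicator (fun _ => Metric.ediam (t n i) ^ m) u
        ≤ ∑' i, L * ⨆ _ : (t n i).Nonempty, Metric.ediam (t n i) ^ (m + 1) := by
          refine ENNReal.tsum_le_tsum fun i => ?_
          rw [lintegral_indicator_const (hImeas n i)]
          rcases (t n i).eq_empty_or_nonempty with h | h
          · simp [hI, h]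
          · rw [ciSup_pos h, ENNReal.rpow_add_of_nonneg _ _ hm zero_le_one, ENNReal.rpow_one]
            calc _ ≤ Metric.ediam (t n i) ^ m * (L * Metric.ediam (t n i)) := by
                  gcongr; exact hIvol n i
              _ = _ := by ring
      _ = L * ∑' i, ⨆ _ : (t n i).Nonempty, Metric.ediam (t n i) ^ (m + 1) := ENNReal.tsum_mul_left
      _ ≤ _ := by gcongr; exact hsum n
  have hlim : Tendsto (fun n => L * (μH[m + 1] S + ε n)) atTop (𝓝 (L * μH[m + 1] S)) := by
    have := ENNReal.Tendsto.const_mul (a := L) (hεt.const_add (μH[m + 1] S)) (Or.inr hL)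
    simpa using this
  calc ∫⁻ u, μH[m] (A u) ≤ ∫⁻ u, liminf (fun n => g n u) atTop := lintegral_mono hpt
    _ ≤ liminf (fun n => ∫⁻ u, g n u) atTop := lintegral_liminf_le hgm
    _ ≤ liminf (fun n => L * (μH[m + 1] S + ε n)) atTop :=
        liminf_le_liminf (Eventually.of_forall hint)
    _ = L * μH[m + 1] S := hlim.liminf_eq

theorem exists_lintegral_euclideanHausdorffMeasure_le (m : ℕ) :
    ∃ K : ℝ, 0 ≤ K ∧ ∀ (X : Type) [EMetricSpace X] [MeasurableSpace X] [BorelSpace X]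
      (L : ℝ) (A : ℝ → Set X), 0 < L →
      (∀ u u' y y', y ∈ A u → y' ∈ A u' → edist u u' ≤ ENNReal.ofReal L * edist y y') →
      ∀ S : Set X, (∀ u, A u ⊆ S) →
        ∫⁻ u, μHE[m] (A u) ≤ ENNReal.ofReal (K * L) * μHE[m + 1] S := by
  set a := Measure.addHaarScalarFactor
    (volume : Measure (EuclideanSpace ℝ (Fin m))) μH[m] with ha
  set b := Measure.addHaarScalarFactor
    (volume : Measure (EuclideanSpace ℝ (Fin (m + 1)))) μH[(m + 1 : ℕ)] with hb
  have hb0 : b ≠ 0 := Measure.addHaarScalarFactor_volume_hausdorffMeasure_ne_zero (m + 1)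
  -- The ratio of the Euclidean normalizing constants in dimensions `m` and `m + 1`.
  refine ⟨(a / b : NNReal), by positivity, ?_⟩
  intro X _ _ _ L A hL hA S hS
  simp only [Measure.euclideanHausdorffMeasure_def, ← ha, ← hb, Measure.smul_apply,
    ENNReal.smul_def, smul_eq_mul]
  rw [lintegral_const_mul' _ _ ENNReal.coe_ne_top]
  have h := lintegral_hausdorffMeasure_le (Nat.cast_nonneg m) (by simpa using hL) ENNReal.ofReal_ne_top A hA hS
  calc _ ≤ (a : ℝ≥0∞) * (ENNReal.ofReal L * μH[(m : ℝ) + 1] S) := by gcongr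
    _ = _ := by
      rw [ENNReal.ofReal_mul (by positivity), ENNReal.ofReal_coe_nnreal, ENNReal.coe_div hb0,
        Nat.cast_add, Nat.cast_one, mul_comm (_ / _) (ENNReal.ofReal L), mul_assoc, ← mul_assoc (_ / _),
        ENNReal.div_mul_cancel (by simpa using hb0) ENNReal.coe_ne_top]
      ring

/-! ### Shrunken copies of the boundary -/

/-- If the images were closer, then for `s' < s` the point `x` would be a convex combination of `x'`
and a point of the open inscribed ball with positive weight on the latter, hence interior to `T`. -/
theorem dist_mul_le_dist_of_mem_frontier {E : Type*} [NormedAddCommGroup E] [NormedSpace ℝ E]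
    {T : Set E} (hT : Convex ℝ T) {c : E} {r : ℝ} (hc : Metric.ball c r ⊆ T) {s s' : ℝ}
    (hs : 0 < s) (hs' : 0 < s') {x x' : E} (hx : x ∈ frontier T) (hx' : x' ∈ frontier T) :
    dist s s' * r ≤ dist (AffineMap.homothety c s x) (AffineMap.homothety c s' x') := by
  wlog hss : s' < s generalizing s s' x x'
  · rcases (not_lt.1 hss).eq_or_lt with rfl | h
    · simp
    · rw [dist_comm s, dist_comm (AffineMap.homothety c s x)]
      exact this hs' hs hx' hx h
  by_contra! hlt
  have hd : 0 < s - s' := sub_pos.2 hss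
  rw [Real.dist_eq, abs_of_pos hd] at hlt
  set y := AffineMap.homothety c s x with hy
  set y' := AffineMap.homothety c s' x' with hy'
  have hb : (s - s')⁻¹ • (y - y') + c ∈ interior T := by
    refine interior_maximal hc Metric.isOpen_ball ?_
    rwa [Metric.mem_ball, dist_eq_norm, add_sub_cancel_right, norm_smul, norm_inv,
      Real.norm_of_nonneg hd.le, inv_mul_lt_iff₀ hd, ← dist_eq_norm]
  have h := hT.combo_closure_interior_mem_interior (frontier_subset_closure hx') hb
    (a := s' / s) (b := (s - s') / s) (by positivity) (by positivity) (by field_simp; ring)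
  have hxe : (s' / s) • x' + ((s - s') / s) • ((s - s')⁻¹ • (y - y') + c) = x := by
    rw [smul_add, smul_smul, hy, hy', AffineMap.homothety_apply, AffineMap.homothety_apply]
    simp only [vsub_eq_sub, vadd_eq_add]
    match_scalars <;> field_simp <;> ring
  rw [hxe] at h
  exact hx.2 h

theorem homothety_mem_of_mem_frontier {E : Type*} [NormedAddCommGroup E] [NormedSpace ℝ E]
    {T : Set E} (hT : Convex ℝ T) {c : E} (hc : c ∈ interior T) {s : ℝ}
    (hs : 0 ≤ s) (hs1 : s < 1) {x : E} (hx : x ∈ frontier T) :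
    AffineMap.homothety c s x ∈ T := by
  have h := hT.combo_closure_interior_mem_interior (frontier_subset_closure hx) hc hs
    (sub_pos.2 hs1) (by ring)
  convert interior_subset h using 1
  rw [AffineMap.homothety_apply, vsub_eq_sub, vadd_eq_add]
  module

theorem exists_lintegral_frontier_homothety_le (m : ℕ) :
    ∃ K : ℝ, 0 ≤ K ∧ ∀ (T : Set (EuclideanSpace ℝ (Fin (m + 1)))) (r τ : ℝ)
      (c : EuclideanSpace ℝ (Fin (m + 1))), Convex ℝ T → 0 < r → Metric.ball c r ⊆ T →
      0 < τ → τ ≤ 1 / 2 → ∀ B : Set (EuclideanSpace ℝ (Fin (m + 1))),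
        ∫⁻ u in Set.Ioo (0 : ℝ) 1, boundaryMeasure T (AffineMap.homothety c (1 - u * τ) ⁻¹' B)
          ≤ ENNReal.ofReal (K / (r * τ)) * volume (B ∩ T) := by
  obtain ⟨K, hK, h⟩ := exists_lintegral_euclideanHausdorffMeasure_le m
  refine ⟨2 ^ m * K, by positivity, ?_⟩
  intro T r τ c hT hr hc hτ hτ2 B
  have hcT : c ∈ interior T :=
    interior_maximal hc Metric.isOpen_ball (Metric.mem_ball_self hr)
  have hscale : ∀ u ∈ Set.Ioo (0 : ℝ) 1, 1 / 2 < 1 - u * τ ∧ 1 - u * τ < 1 := fun u hu =>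
    ⟨by nlinarith [hu.1, hu.2], by nlinarith [hu.1, hu.2]⟩
  -- Slices are empty for `u` outside `(0, 1)`, so the Lipschitz condition holds for all real
  -- parameters.
  set A : ℝ → Set (EuclideanSpace ℝ (Fin (m + 1))) := fun u =>
    {y | u ∈ Set.Ioo (0 : ℝ) 1 ∧ y ∈ B ∧ y ∈ AffineMap.homothety c (1 - u * τ) '' frontier T}
    with hAdef
  have hA : ∀ u u' y y', y ∈ A u → y' ∈ A u' →
      edist u u' ≤ ENNReal.ofReal (1 / (r * τ)) * edist y y' := by
    rintro u u' _ _ ⟨hu, -, x, hx, rfl⟩ ⟨hu', -, x', hx', rfl⟩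
    have h1 := dist_mul_le_dist_of_mem_frontier hT hc (s := 1 - u * τ) (s' := 1 - u' * τ)
      (by linarith [hscale u hu]) (by linarith [hscale u' hu']) hx hx'
    rw [edist_dist, edist_dist, ← ENNReal.ofReal_mul (by positivity)]
    refine ENNReal.ofReal_le_ofReal ?_
    rw [div_mul_eq_mul_div, one_mul, le_div_iff₀ (by positivity)]
    refine le_trans (le_of_eq ?_) h1
    rw [Real.dist_eq, Real.dist_eq,
      show 1 - u * τ - (1 - u' * τ) = -((u - u') * τ) by ring, abs_neg, abs_mul, abs_of_pos hτ]
    ring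
  have hS : ∀ u, A u ⊆ B ∩ T := by
    rintro u _ ⟨hu, hB, x, hx, rfl⟩
    exact ⟨hB, homothety_mem_of_mem_frontier hT hcT (by linarith [hscale u hu])
      (hscale u hu).2 hx⟩
  have hpt : ∀ u ∈ Set.Ioo (0 : ℝ) 1,
      boundaryMeasure T (AffineMap.homothety c (1 - u * τ) ⁻¹' B) ≤ 2 ^ m * μHE[m] (A u) := by
    intro u hu
    have hs := (hscale u hu).1
    rw [boundaryMeasure, Measure.restrict_apply' isClosed_frontier.measurableSet,
      Nat.add_sub_cancel]
    calc _ ≤ μHE[m] (AffineMap.homothety c (1 - u * τ) ⁻¹' (A u)) :=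
          measure_mono fun x hx => ⟨hu, hx.1, x, hx.2, rfl⟩
      _ = ‖1 - u * τ‖₊⁻¹ ^ m • μHE[m] (A u) :=
          euclideanHausdorffMeasure_homothety_preimage m c (by linarith) _
      _ ≤ _ := by
        rw [ENNReal.smul_def, smul_eq_mul]
        gcongr
        have h2 : ‖1 - u * τ‖₊⁻¹ ≤ 2 := by
          rw [← NNReal.coe_le_coe, NNReal.coe_inv, coe_nnnorm,
            Real.norm_of_nonneg (by linarith)]
          exact inv_le_of_inv_le₀ (by norm_num) (by norm_num; linarith)
        calc ((‖1 - u * τ‖₊⁻¹ ^ m : NNReal) : ℝ≥0∞) ≤ ((2 ^ m : NNReal) : ℝ≥0∞) := by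
              gcongr
          _ = 2 ^ m := by simp
  calc _ ≤ ∫⁻ u in Set.Ioo (0 : ℝ) 1, 2 ^ m * μHE[m] (A u) :=
        setLIntegral_mono' measurableSet_Ioo hpt
    _ ≤ ∫⁻ u, 2 ^ m * μHE[m] (A u) := setLIntegral_le_lintegral _ _
    _ = 2 ^ m * ∫⁻ u, μHE[m] (A u) := lintegral_const_mul' _ _ (by simp)
    _ ≤ 2 ^ m * (ENNReal.ofReal (K * (1 / (r * τ))) * μHE[m + 1] (B ∩ T)) := by
        gcongr
        exact h _ _ A (by positivity) hA _ hS
    _ = _ := by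
        rw [EuclideanSpace.euclideanHausdorffMeasure_eq_volume, ← mul_assoc, mul_one_div,
          mul_div_assoc, ENNReal.ofReal_mul (by positivity), ENNReal.ofReal_pow (by norm_num)]
        simp

/-- Needed for the product measures below. A ball about `c` is mapped into itself by contractions
towards `c`, so the averaged bound controls its boundary measure by its volume. -/
theorem isLocallyFiniteMeasure_boundaryMeasure {m : ℕ} {T : Set (EuclideanSpace ℝ (Fin (m + 1)))}
    {r : ℝ} {c : EuclideanSpace ℝ (Fin (m + 1))} (hT : Convex ℝ T) (hr : 0 < r)
    (hc : Metric.ball c r ⊆ T) : IsLocallyFiniteMeasure (boundaryMeasure T) := by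
  obtain ⟨K, hK, h⟩ := exists_lintegral_frontier_homothety_le m
  refine ⟨fun x => ⟨Metric.ball c (dist x c + 1), Metric.isOpen_ball.mem_nhds (by simp), ?_⟩⟩
  set B := Metric.ball c (dist x c + 1)
  have h1 := h T r (1 / 2) c hT hr hc (by norm_num) le_rfl B
  refine lt_of_le_of_lt ?_ (lt_of_le_of_lt h1 (ENNReal.mul_lt_top ENNReal.ofReal_lt_top
    ((measure_mono Set.inter_subset_left).trans_lt measure_ball_lt_top)))
  calc boundaryMeasure T B = ∫⁻ u in Set.Ioo (0 : ℝ) 1, boundaryMeasure T B := by simp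
    _ ≤ _ := by
      refine setLIntegral_mono' measurableSet_Ioo fun u hu => measure_mono fun y hy => ?_
      rw [Set.mem_preimage, Metric.mem_ball, dist_homothety_center,
        Real.norm_of_nonneg (by linarith [hu.2])]
      have := Metric.mem_ball.1 hy
      rw [dist_comm] at this
      nlinarith [hu.1, hu.2, dist_nonneg (x := c) (y := y)]

/-! ### The trace inequality and the conclusion -/

theorem exists_map_homothety_le (m : ℕ) :
    ∃ K : ℝ, 0 ≤ K ∧ ∀ (T : Set (EuclideanSpace ℝ (Fin (m + 1)))) (r τ : ℝ)
      (c : EuclideanSpace ℝ (Fin (m + 1))), Convex ℝ T → 0 < r → Metric.ball c r ⊆ T →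
      0 < τ → τ ≤ 1 / 2 →
        Measure.map (fun z : ℝ × EuclideanSpace ℝ (Fin (m + 1)) => z.2 + τ • z.1 • (c - z.2))
            ((volume.restrict (Set.Ioo 0 1)).prod (boundaryMeasure T))
          ≤ ENNReal.ofReal (K / (r * τ)) • volume.restrict T := by
  obtain ⟨K, hK, h⟩ := exists_lintegral_frontier_homothety_le m
  refine ⟨K, hK, ?_⟩
  intro T r τ c hT hr hc hτ hτ2
  have := isLocallyFiniteMeasure_boundaryMeasure hT hr hc
  refine Measure.le_iff.2 fun B hB => ?_
  have hm : Measurable fun z : ℝ × EuclideanSpace ℝ (Fin (m + 1)) =>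
      z.2 + τ • z.1 • (c - z.2) := by fun_prop
  rw [Measure.map_apply hm hB, Measure.prod_apply (hm hB), Measure.smul_apply,
    Measure.restrict_apply hB, smul_eq_mul]
  refine (lintegral_mono fun u => measure_mono fun x hx => ?_).trans (h T r τ c hT hr hc hτ hτ2 B)
  rw [Set.mem_preimage, AffineMap.homothety_apply, vsub_eq_sub, vadd_eq_add]
  convert Set.mem_preimage.1 (Set.mem_preimage.1 hx) using 1
  module

theorem exists_eLpNorm_boundaryMeasure_le (m p : ℕ) :
    ∃ C : ℝ, 0 ≤ C ∧ ∀ (T : Set (EuclideanSpace ℝ (Fin (m + 1)))) (r : ℝ)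
      (c : EuclideanSpace ℝ (Fin (m + 1))), Convex ℝ T → 0 < r → Metric.ball c r ⊆ T →
        ∀ v : MvPolynomial (Fin (m + 1)) ℝ, v.totalDegree ≤ p →
          eLpNorm (polyFun v) 2 (boundaryMeasure T)
              ≤ ENNReal.ofReal (C / √r) * eLpNorm (polyFun v) 2 (volume.restrict T) := by
  obtain ⟨a, ha⟩ := exists_extrapolation (d := m + 1) (node_injective p)
  obtain ⟨K, hK, h⟩ := exists_map_homothety_le m
  set δ : ℝ := 1 / (2 * (p + 1)) with hδ
  have hδ0 : 0 < δ := by positivity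
  refine ⟨(∑ i, |a i|) * √(K / δ), by positivity, ?_⟩
  intro T r c hT hr hc v hv
  have := isLocallyFiniteMeasure_boundaryMeasure hT hr hc
  have : IsProbabilityMeasure ((volume : Measure ℝ).restrict (Set.Ioo 0 1)) := ⟨by simp⟩
  have hv0 := continuous_polyFun v
  set P := (volume.restrict (Set.Ioo (0 : ℝ) 1)).prod (boundaryMeasure T) with hP
  have hsnd : MeasurePreserving Prod.snd P (boundaryMeasure T) := measurePreserving_snd
  -- The parameter `u` has total mass one, so introducing it leaves the boundary norm unchanged.
  rw [← eLpNorm_comp_measurePreserving hv0.aestronglyMeasurable hsnd]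
  have hrep : polyFun v ∘ Prod.snd = fun z : ℝ × EuclideanSpace ℝ (Fin (m + 1)) =>
      ∑ i, a i * polyFun v (z.2 + node p i • z.1 • (c - z.2)) :=
    funext fun z => ha v hv z.2 (z.1 • (c - z.2))
  rw [hrep]
  refine (eLpNorm_sum_mul_le (K := √(K / δ) / √r) _ _
    (fun i => Continuous.aestronglyMeasurable (by fun_prop)) (by positivity) fun i => ?_).trans_eq
    (by rw [mul_div_assoc])
  refine (eLpNorm_comp_le_of_map_le (by fun_prop)
    (h T r (node p i) c hT hr hc (node_pos p i) (node_le_half p i))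
    hv0.stronglyMeasurable).trans ?_
  rw [← Real.sqrt_div' _ hr.le, div_div, mul_comm r]
  have := le_node p i
  gcongr

theorem mainTheorem5 (d p : ℕ) (hd : 1 ≤ d) :
    ∃ C : ℝ, 0 < C ∧
      ∀ (T : Set (EuclideanSpace ℝ (Fin d))) (r : ℝ),
        Convex ℝ T → (interior T).Nonempty → IsInradius T r →
        ∀ v : MvPolynomial (Fin d) ℝ, v.totalDegree ≤ p →
          eLpNorm (gradient (polyFun v)) 2 (volume.restrict T)
              ≤ ENNReal.ofReal (C / r) * eLpNorm (polyFun v) 2 (volume.restrict T) ∧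
          eLpNorm (polyFun v) 2 (boundaryMeasure T)
              ≤ ENNReal.ofReal (C / √r) * eLpNorm (polyFun v) 2 (volume.restrict T) := by
  obtain ⟨m, rfl⟩ : ∃ m, d = m + 1 := ⟨d - 1, by omega⟩
  obtain ⟨C₁, hC₁, h₁⟩ := exists_eLpNorm_gradient_le (m + 1) p
  obtain ⟨C₂, hC₂, h₂⟩ := exists_eLpNorm_boundaryMeasure_le m p
  -- The summand `1` only ensures strict positivity.
  refine ⟨C₁ + C₂ + 1, by positivity, ?_⟩
  rintro T r hT ⟨x, hx⟩ ⟨⟨c, hc⟩, hmax⟩ v hv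
  -- Maximality of `r` serves only here; the estimates hold for any inscribed ball of positive
  -- radius.
  have hr : 0 < r := by
    obtain ⟨ε, hε, hball⟩ := Metric.isOpen_iff.1 isOpen_interior x hx
    exact hε.trans_le (hmax ⟨x, hball.trans interior_subset⟩)
  constructor
  · refine (h₁ T r c hT hr hc v hv).trans ?_
    gcongr
    linarith
  · refine (h₂ T r c hT hr hc v hv).trans ?_
    gcongr
    linarith
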